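/- Let $(M,g,J)$ be a Kähler manifold with Ricci form $\rho(X,Y)=\mathrm{Ric}(JX,Y)$ and let $\lambda\in\mathbb R$. A smooth curve $\alpha:I\to M$ on an interval $I$ is a *Ricci magnetic geodesic with parameter $\lambda$* (RMG$_\lambda$) if $$\nabla^{\alpha}_{d/dt}\dot\alpha=\lambda\,\sharp\,\iota_{\dot\alpha}\rho ,$$ where $\nabla$ is the Levi-Civita connexion and $\sharp:T^*M\to TM$ the metric isomorphism. The RMG$_\lambda$ flow on $M$ is *complete* if for all $x\in M$ and $v\in T_xM$ there is an RMG$_\lambda$ curve $\alpha:\mathbb R\to M$ with $\alpha(0)=x$ and $\dot\alpha(0)=v$; otherwise it is *incomplete*. For $n\ge 1$ let $\mathsf{Rat}_n$ be the space of degree $n$ holomorphic maps $S^2\to S^2$, written as rational functions $W(z)$ in stereographic coordinates, and let $\mathsf{Rat}_n^{eq}\subset\mathsf{Rat}_n$ be the fixed point set of the circle action $W(z)\mapsto e^{in\theta}W(e^{-i\theta}z)$, $\theta\in\mathbb R$; it consists of the maps $W(z)=cz^n$ with $c\in\mathbb C^\times=\mathbb C\setminus\{0\}$, and is a Kähler manifold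 with global holomorphic coordinate $c$ and the induced $L^2$ metric (for unit spheres) $$\gamma^{eq}_{L^2}(u,v)=\int_{\mathbb C}\frac{4\,\mathrm{Re}\bigl(\partial_uW\,\overline{\partial_vW}\bigr)}{(1+|W|^2)^2}\,\frac{4\,dx\,dy}{(1+|z|^2)^2},\qquad W(z)=cz^n,\quad \partial_uW(z)=uz^n,\quad u,v\in\mathbb C\cong T_c\mathsf{Rat}_n^{eq}.$$ Then for every $n\ge 5$ and every $\lambda\in\mathbb R$ the intrinsic RMG$_\lambda$ flow on $(\mathsf{Rat}_n^{eq},\gamma^{eq}_{L^2})$, i.e. the RMG$_\lambda$ flow defined by the Levi-Civita connexion and the Ricci form of $\gamma^{eq}_{L^2}$ itself, is incomplete. -/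

import Mathlib

set_option maxSynthPendingDepth 3

open scoped ContDiff

noncomputable section

namespace RMG

/-! ### Kähler geometry in a coordinate domain

`E` is a real vector space with a constant complex structure `J`, the coordinate space of a
holomorphic chart.  A metric is a map `g : E → E →L[ℝ] E →L[ℝ] ℝ`; only its values on the
image of the chart (an open set) matter. -/

section Kahler

variable {E : Type*} [NormedAddCommGroup E] [NormedSpace ℝ E]

/-- The metric isomorphism `♯ : T*M → TM` at `x`, the inverse of `v ↦ g x v`. -/
def sharp (g : E → E →L[ℝ] E →L[ℝ] ℝ) (x : E) : (E →L[ℝ] ℝ) →L[ℝ] E :=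
  ContinuousLinearMap.inverse (g x)

/-- Christoffel symbols of the first kind,
`(u, v, w) ↦ (1/2) (∂ᵤ g(v, w) + ∂ᵥ g(u, w) - ∂_w g(u, v))`. -/
def christoffelLower (g : E → E →L[ℝ] E →L[ℝ] ℝ) (x : E) : E →L[ℝ] E →L[ℝ] E →L[ℝ] ℝ :=
  let T : E →L[ℝ] E →L[ℝ] E →L[ℝ] ℝ := fderiv ℝ g x
  let T' : E →L[ℝ] E →L[ℝ] E →L[ℝ] ℝ :=
    (ContinuousLinearMap.flipₗᵢ ℝ E E ℝ).toContinuousLinearEquiv.toContinuousLinearMap.comp T.flip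
  (1 / 2 : ℝ) • (T + T.flip - T')

theorem christoffelLower_apply (g : E → E →L[ℝ] E →L[ℝ] ℝ) (x u v w : E) :
    christoffelLower g x u v w =
      (1 / 2) * (fderiv ℝ g x u v w + fderiv ℝ g x v u w - fderiv ℝ g x w u v) := rfl

/-- Christoffel symbols `Γ x (u, v)` of the Levi-Civita connexion of `g`:
for constant vector fields `u`, `v` one has `∇ᵤ v = Γ(u, v)`. -/
def christoffel (g : E → E →L[ℝ] E →L[ℝ] ℝ) (x : E) : E →L[ℝ] E →L[ℝ] E :=
  ContinuousLinearMap.compL ℝ E (E →L[ℝ] ℝ) E (sharp g x) ∘L christoffelLower g x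

theorem christoffel_apply (g : E → E →L[ℝ] E →L[ℝ] ℝ) (x u v : E) :
    christoffel g x u v = sharp g x (christoffelLower g x u v) := rfl

/-- For fixed `Y`, `Z`, the endomorphism `X ↦ R(X, Y) Z`, where
`R(X, Y) Z = ∇_X ∇_Y Z - ∇_Y ∇_X Z - ∇_{[X, Y]} Z` is the Riemann curvature tensor. -/
def curvature (g : E → E →L[ℝ] E →L[ℝ] ℝ) (x Y Z : E) : E →L[ℝ] E :=
  ((fderiv ℝ (christoffel g) x).flip Y).flip Z - (fderiv ℝ (christoffel g) x Y).flip Z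
    + (christoffel g x).flip (christoffel g x Y Z)
    - christoffel g x Y ∘L (christoffel g x).flip Z

theorem curvature_apply (g : E → E →L[ℝ] E →L[ℝ] ℝ) (x X Y Z : E) :
    curvature g x Y Z X =
      fderiv ℝ (christoffel g) x X Y Z - fderiv ℝ (christoffel g) x Y X Z
        + christoffel g x X (christoffel g x Y Z)
        - christoffel g x Y (christoffel g x X Z) := rfl

/-- The Ricci tensor, `Ric(Y, Z) = tr (X ↦ R(X, Y) Z)`. -/
def ricci (g : E → E →L[ℝ] E →L[ℝ] ℝ) (x Y Z : E) : ℝ :=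
  LinearMap.trace ℝ E (curvature g x Y Z).toLinearMap

/-- The Ricci form, `ρ(X, Y) = Ric(J X, Y)`. -/
def ricciForm (J : E →L[ℝ] E) (g : E → E →L[ℝ] E →L[ℝ] ℝ) (x X Y : E) : ℝ :=
  ricci g x (J X) Y

/-- The covariant acceleration `∇_{d/dt} α'` of a curve. -/
def covAccel (g : E → E →L[ℝ] E →L[ℝ] ℝ) (α : ℝ → E) (t : ℝ) : E :=
  deriv (deriv α) t + christoffel g (α t) (deriv α t) (deriv α t)

/-- A smooth curve `α : ℝ → E` is Ricci magnetic geodesic with parameter `lam` if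
`∇_{d/dt} α' = lam ♯ ι_{α'} ρ`, that is, `g(∇_{d/dt} α', w) = lam ρ(α', w)` for every `w`. -/
def IsRMG (J : E →L[ℝ] E) (g : E → E →L[ℝ] E →L[ℝ] ℝ) (lam : ℝ) (α : ℝ → E) : Prop :=
  ContDiff ℝ ∞ α ∧
    ∀ t w, g (α t) (covAccel g α t) w = lam * ricciForm J g (α t) (deriv α t) w

end Kahler

/-! ### Rational maps and the `L²` metric -/

/-- Degree `n` rational maps: `W = p / q` in lowest terms with `max (deg p) (deg q) = n`.
For `n ≥ 1` these are the degree `n` holomorphic maps from the sphere to itself. -/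
def RatMaps (n : ℕ) : Set (RatFunc ℂ) :=
  {W | max W.num.natDegree W.denom.natDegree = n}

/-- The circle action: `rotate n θ W` is the map `z ↦ e^{i n θ} W(e^{-i θ} z)`. -/
def rotate (n : ℕ) (θ : ℝ) (W : RatFunc ℂ) : RatFunc ℂ :=
  RatFunc.C (Complex.exp (Complex.I * n * θ)) *
    W.eval RatFunc.C (RatFunc.C (Complex.exp (-(Complex.I * θ))) * RatFunc.X)

/-- The rotationally equivariant rational maps of degree `n`: the fixed point set in `RatMaps n` of
the circle action. -/
def RatEq (n : ℕ) : Set (RatFunc ℂ) :=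
  {W | W ∈ RatMaps n ∧ ∀ θ : ℝ, rotate n θ W = W}

/-- The rational map `z ↦ c z ^ n`. -/
def lump (n : ℕ) (c : ℂ) : RatFunc ℂ := RatFunc.C c * RatFunc.X ^ n

/-- The holomorphic coordinate `c` of the map `z ↦ c z ^ n`, namely its value at `z = 1`. -/
def coord (W : RatFunc ℂ) : ℂ := W.eval (RingHom.id ℂ) 1

theorem eval_lump (n : ℕ) (c z : ℂ) : (lump n c).eval (RingHom.id ℂ) z = c * z ^ n := by
  have h : lump n c = algebraMap (Polynomial ℂ) (RatFunc ℂ)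
      (Polynomial.C c * Polynomial.X ^ n) := by
    simp [lump, RatFunc.algebraMap_C, RatFunc.algebraMap_X]
  rw [h, RatFunc.eval_algebraMap]
  simp

theorem coord_lump (n : ℕ) (c : ℂ) : coord (lump n c) = c := by
  simp [coord, eval_lump]

open Polynomial in
/-- For `n ≥ 1` the maps `z ↦ c z ^ n` with `c ≠ 0` are exactly the points of `RatEq n`, so
`coord` is a bijection from `RatEq n` to the nonzero complex numbers. -/
theorem mem_ratEq_iff {n : ℕ} (hn : n ≠ 0) (W : RatFunc ℂ) :
    W ∈ RatEq n ↔ ∃ c : ℂ, c ≠ 0 ∧ W = lump n c := by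
  have key : ∀ (W : RatFunc ℂ) (θ : ℝ), rotate n θ W = W ↔
      C (Complex.exp (Complex.I * n * θ)) * (W.num.comp (C (Complex.exp (-(Complex.I * θ))) * X)) * W.denom
        = W.num * (W.denom.comp (C (Complex.exp (-(Complex.I * θ))) * X)) := by
    intro W θ
    have e : ∀ p : ℂ[X], p.eval₂ RatFunc.C (RatFunc.C (Complex.exp (-(Complex.I * θ))) * RatFunc.X)
        = algebraMap ℂ[X] (RatFunc ℂ) (p.comp (C (Complex.exp (-(Complex.I * θ))) * X)) := by
      intro p
      rw [Polynomial.comp, Polynomial.hom_eval₂]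
      congr 1
      simp
    have hd : W.denom.comp (C (Complex.exp (-(Complex.I * θ))) * X) ≠ 0 := by
      intro h
      have := congrArg (fun q => q.comp (C (Complex.exp ((Complex.I * θ))) * X)) h
      simp only [Polynomial.comp_assoc, Polynomial.zero_comp] at this
      rw [show (C (Complex.exp (-(Complex.I * θ))) * X : ℂ[X]).comp (C (Complex.exp ((Complex.I * θ))) * X) = X by
        simp [← mul_assoc, ← C_mul, ← Complex.exp_add], Polynomial.comp_X] at this
      exact W.denom_ne_zero this
    have hd' := (RatFunc.algebraMap_ne_zero hd)
    have hq' := (RatFunc.algebraMap_ne_zero W.denom_ne_zero)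
    unfold rotate RatFunc.eval
    rw [e, e]
    conv_lhs => rhs; rw [← RatFunc.num_div_denom W]
    rw [← mul_div_assoc, div_eq_div_iff hd' hq', ← RatFunc.algebraMap_C, ← map_mul, ← map_mul, ← map_mul]
    exact (RatFunc.algebraMap_injective ℂ).eq_iff
  have num_lump : ∀ c : ℂ, (lump n c).num = C c * X ^ n ∧ (lump n c).denom = 1 := by
    intro c
    have h : lump n c = algebraMap ℂ[X] (RatFunc ℂ) (C c * X ^ n) := by
      simp [lump, RatFunc.algebraMap_C, RatFunc.algebraMap_X]
    rw [h, RatFunc.num_algebraMap, RatFunc.denom_algebraMap]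
    exact ⟨rfl, rfl⟩
  constructor
  · rintro ⟨hW, hfix⟩
    set p := W.num with hp
    set q := W.denom with hq
    have hq0 : q ≠ 0 := W.denom_ne_zero
    obtain ⟨x, hx0, hx⟩ : ∃ x : ℂ, x ≠ 0 ∧ q.eval x ≠ 0 := by
      by_contra! h
      have : (X * q : ℂ[X]) = 0 := by
        apply Polynomial.funext
        intro r
        by_cases hr : r = 0
        · simp [hr]
        · simp [h r hr]
      simp [hq0] at this
    -- `p = k X ^ n q`
    have hk : p * C (x ^ n * q.eval x) = C (p.eval x) * X ^ n * q := by
      apply Polynomial.eq_of_infinite_eval_eq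
      have hinf : (Set.range (fun θ : Set.Ioo (-Real.pi) Real.pi => Complex.exp (-(Complex.I * (θ : ℝ))) * x)).Infinite := by
        have : Infinite (Set.Ioo (-Real.pi) Real.pi) := (Set.Ioo_infinite (by linarith [Real.pi_pos])).to_subtype
        apply Set.infinite_range_of_injective
        intro a b hab
        have h1 := mul_right_cancel₀ hx0 hab
        have h2 : Complex.exp (((-(a : ℝ) : ℝ) : ℂ) * Complex.I) = Complex.exp (((-(b : ℝ) : ℝ) : ℂ) * Complex.I) := by
          push_cast
          convert h1 using 2 <;> ring
        have h3 := congrArg Complex.arg h2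
        rw [Complex.arg_exp_mul_I, Complex.arg_exp_mul_I] at h3
        have ha := a.2
        have hb := b.2
        rw [(toIocMod_eq_self _).2 ⟨by linarith [ha.2], by linarith [ha.1]⟩,
          (toIocMod_eq_self _).2 ⟨by linarith [hb.2], by linarith [hb.1]⟩] at h3
        exact Subtype.ext (neg_injective h3)
      refine hinf.mono ?_
      rintro _ ⟨θ, rfl⟩
      have h := (key W θ).1 (hfix θ)
      have h2 := congrArg (Polynomial.eval x) h
      simp only [eval_mul, eval_C, eval_comp, eval_X] at h2
      simp only [Set.mem_ofPred_eq, eval_mul, eval_C, eval_pow, eval_X]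
      have h3 : Complex.exp (Complex.I * n * (θ : ℝ)) * Complex.exp (-(Complex.I * (θ : ℝ))) ^ n = 1 := by
        rw [← Complex.exp_nat_mul, ← Complex.exp_add]
        rw [show (n : ℂ) * -(Complex.I * (θ : ℝ)) = -(Complex.I * n * (θ : ℝ)) by ring,
          add_neg_cancel, Complex.exp_zero]
      rw [← hp, ← hq] at h2
      rw [mul_pow]
      linear_combination (x ^ n * Complex.exp (-(Complex.I * (θ : ℝ))) ^ n) * h2 - (eval (Complex.exp (-(Complex.I * (θ : ℝ))) * x) p * q.eval x * x ^ n) * h3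
    set c := p.eval x / (x ^ n * q.eval x) with hc
    have hne : x ^ n * q.eval x ≠ 0 := mul_ne_zero (pow_ne_zero _ hx0) hx
    have hWc : W = lump n c := by
      rw [← RatFunc.num_div_denom W, div_eq_iff (RatFunc.algebraMap_ne_zero hq0)]
      have h1 : p = C c * X ^ n * q := by
        have : C (x ^ n * q.eval x) ≠ 0 := by simpa using hne
        apply mul_right_cancel₀ this
        rw [hk]
        have : C (p.eval x) = C c * C (x ^ n * q.eval x) := by
          rw [← C_mul, hc, div_mul_cancel₀ _ hne]
        rw [this]; ring
      rw [← hp, h1]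
      simp [lump, RatFunc.algebraMap_C, RatFunc.algebraMap_X, hq]
    refine ⟨c, ?_, hWc⟩
    intro h0
    have h1 : max W.num.natDegree W.denom.natDegree = n := hW
    rw [hWc, (num_lump c).1, (num_lump c).2, h0] at h1
    simp at h1
    exact hn h1.symm
  · rintro ⟨c, hc, rfl⟩
    refine ⟨?_, fun θ => ?_⟩
    · show max _ _ = n
      rw [(num_lump c).1, (num_lump c).2]
      simp [natDegree_C_mul_X_pow n c hc]
    · rw [key, (num_lump c).1, (num_lump c).2]
      have h3 : Complex.exp (Complex.I * n * θ) * Complex.exp (-(Complex.I * θ)) ^ n = 1 := by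
        rw [← Complex.exp_nat_mul, ← Complex.exp_add]
        rw [show (n : ℂ) * -(Complex.I * (θ : ℝ)) = -(Complex.I * n * (θ : ℝ)) by ring,
          add_neg_cancel, Complex.exp_zero]
      have h4 : C (Complex.exp (Complex.I * n * θ)) * C (Complex.exp (-(Complex.I * θ))) ^ n = (1 : ℂ[X]) := by
        rw [← C_pow, ← C_mul, h3, C_1]
      simp [mul_pow]
      linear_combination C c * X ^ n * h4

/-- The pullback, to the parameter space `E` of a family `W : E → RatFunc ℂ` of rational maps, of
the `L²` metric.  In stereographic coordinates `z`, `W` on the domain and codomain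
(both unit spheres, with metric `4 |dz|² / (1 + |z|²)²`) this is
`(u, v) ↦ ∫ 4 ⟪∂ᵤ W, ∂ᵥ W⟫ / (1 + |W|²)² · 4 dx dy / (1 + |z|²)²`. -/
def l2Metric {E : Type*} [NormedAddCommGroup E] [NormedSpace ℝ E] (W : E → RatFunc ℂ) (x : E) :
    E →L[ℝ] E →L[ℝ] ℝ :=
  ∫ z : ℂ, (4 / (1 + ‖(W x).eval (RingHom.id ℂ) z‖ ^ 2) ^ 2 * (4 / (1 + ‖z‖ ^ 2) ^ 2)) •
    (innerSL ℝ : ℂ →L[ℝ] ℂ →L[ℝ] ℝ).bilinearComp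
      (fderiv ℝ (fun y => (W y).eval (RingHom.id ℂ) z) x)
      (fderiv ℝ (fun y => (W y).eval (RingHom.id ℂ) z) x)

/-- The `L²` metric on `RatEq n`, in the coordinate `c`. -/
def eqMetric (n : ℕ) : ℂ → ℂ →L[ℝ] ℂ →L[ℝ] ℝ := l2Metric (lump n)

/-- Multiplication by `i`. -/
def complexJ : ℂ →L[ℝ] ℂ := ContinuousLinearMap.mul ℝ ℂ Complex.I

/-- The intrinsic Ricci magnetic geodesic flow on `RatEq n` with parameter `lam` is complete:
for every point `W₀` and every tangent vector at `W₀` (with component `v` in the coordinate `c`)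
there is a Ricci magnetic geodesic `α : ℝ → RatEq n` with `α(0) = W₀` and `α'(0) = v`. -/
def IntrinsicComplete (n : ℕ) (lam : ℝ) : Prop :=
  ∀ (W₀ : RatEq n) (v : ℂ), ∃ α : ℝ → RatEq n,
    IsRMG complexJ (eqMetric n) lam (fun t => coord (α t)) ∧
      α 0 = W₀ ∧ deriv (fun t => coord (α t)) 0 = v

end RMG

end

/-! The metric is F(|c|²)|dc|² (`eqMetric_eq`). With ρ = |c|^(1/n), the substitution z = y/ρ gives
ρ^(2n-2) F = 16 G₂(ρ²), where G₂ = `scaledMoment n 2` stays between positive bounds as ρ → 0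
(`lumpMoment_scaling`). As d|c| = n ρ^(n-1) dρ, radial length is comparable to ρ, so the missing
point c = 0 lies at finite distance. It remains to find magnetic curves that reach it.

The flow conserves the energy F|α'|². With s = |c|², the Ricci form is -2 (sF'/F)' dx∧dy, so F
Im(ᾱα') + lam sF'/F is conserved too. As c → 0, sF'/F tends to (1-n)/n (`logDeriv_lumpFactor`). If
the momentum is lam times this limit, then F Im(ᾱα') = O(ρ²) and there is no centrifugal barrier.
For large energy this forces |ρ'| ≥ 1 while ρ ≤ 1 (`one_le_sq_of_conserved`). A curve that starts
inwards from c = 1 would hit ρ = 0 by time 1, so it cannot stay in the nonzero numbers for all time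
(`false_of_steep`). -/

noncomputable section

open scoped ComplexConjugate

namespace RMG

/-! ### Connexion and Ricci form of rotationally symmetric metrics on ℂ. -/

/-- The real inner product of `ℂ` as a continuous bilinear form. -/
def innerForm : ℂ →L[ℝ] ℂ →L[ℝ] ℝ := innerSL ℝ

theorem innerForm_apply (u v : ℂ) : innerForm u v = u.re * v.re + u.im * v.im := by
  change inner ℝ u v = _
  rw [Complex.inner]
  simp
  ring

/-- The rotationally symmetric conformal metric `F(|x|²) |dx|²` on `ℂ`. -/
def radialMetric (F : ℝ → ℝ) (x : ℂ) : ℂ →L[ℝ] ℂ →L[ℝ] ℝ := F (‖x‖ ^ 2) • innerForm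

theorem radialMetric_apply (F : ℝ → ℝ) (x u v : ℂ) :
    radialMetric F x u v = F (‖x‖ ^ 2) * (u.re * v.re + u.im * v.im) := by
  simp [radialMetric, innerForm_apply]

theorem normSq_pos {x : ℂ} (hx : x ≠ 0) : 0 < ‖x‖ ^ 2 := by positivity

theorem norm_sq_eq (x : ℂ) : ‖x‖ ^ 2 = x.re ^ 2 + x.im ^ 2 := by
  rw [Complex.sq_norm, Complex.normSq_apply]; ring

theorem hasFDerivAt_comp_normSq {f : ℝ → ℝ} {f' : ℝ} {x : ℂ}
    (h : HasDerivAt f f' (‖x‖ ^ 2)) :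
    HasFDerivAt (fun y : ℂ => f (‖y‖ ^ 2)) (f' • ((2 : ℝ) • innerForm x)) x :=
  h.comp_hasFDerivAt x (((hasStrictFDerivAt_norm_sq x).hasFDerivAt).congr_fderiv
    (ofNat_smul_eq_nsmul ℝ 2 (innerForm x)).symm)

theorem fderiv_radialMetric {F : ℝ → ℝ} {F' : ℝ} {x : ℂ} (h : HasDerivAt F F' (‖x‖ ^ 2))
    (u v w : ℂ) :
    fderiv ℝ (radialMetric F) x u v w =
      2 * F' * (x.re * u.re + x.im * u.im) * (v.re * w.re + v.im * w.im) := by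
  have := ((hasFDerivAt_comp_normSq h).smul_const innerForm).fderiv
  change fderiv ℝ (radialMetric F) x = _ at this
  rw [this]
  simp only [ContinuousLinearMap.smulRight_apply, smul_apply, smul_eq_mul,
    innerForm_apply]
  ring

/-- A nonzero multiple of the inner product of `ℂ` as an isomorphism onto the dual. -/
def dualEquiv (a : ℝ) (ha : a ≠ 0) : ℂ ≃L[ℝ] (ℂ →L[ℝ] ℝ) :=
  ContinuousLinearEquiv.equivOfInverse (a • innerForm)
    (a⁻¹ • ((ContinuousLinearMap.apply ℝ ℝ (1 : ℂ)).smulRight (1 : ℂ) +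
      (ContinuousLinearMap.apply ℝ ℝ Complex.I).smulRight Complex.I))
    (fun u => by
      apply Complex.ext <;> simp [innerForm_apply, ha])
    (fun l => by
      ext w
      have hw : w = w.re • (1 : ℂ) + w.im • Complex.I := by
        apply Complex.ext <;> simp
      conv_rhs => rw [hw, map_add, map_smul, map_smul]
      simp [innerForm_apply]
      field_simp)

theorem sharp_radialMetric {F : ℝ → ℝ} {x : ℂ} (h : F (‖x‖ ^ 2) ≠ 0) (y : ℂ) :
    sharp (radialMetric F) x (radialMetric F x y) = y := by
  have e : radialMetric F x = (dualEquiv _ h : ℂ →L[ℝ] ℂ →L[ℝ] ℝ) := rfl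
  rw [sharp, e, ContinuousLinearMap.inverse_equiv]
  exact (dualEquiv _ h).symm_apply_apply y

/-- In one complex dimension a conformal metric is Kähler, so its connexion is complex bilinear with
coefficient ∂ log F, which is (F'/F) x̄ here. -/
theorem christoffel_radialMetric {F : ℝ → ℝ} {F' : ℝ} {x : ℂ} (h : HasDerivAt F F' (‖x‖ ^ 2))
    (h0 : F (‖x‖ ^ 2) ≠ 0) :
    christoffel (radialMetric F) x =
      (((F' / F (‖x‖ ^ 2) : ℝ) : ℂ) * conj x) • ContinuousLinearMap.mul ℝ ℂ := by
  ext1 u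
  ext1 v
  have : christoffelLower (radialMetric F) x u v =
      radialMetric F x (((F' / F (‖x‖ ^ 2) : ℝ) : ℂ) * conj x * (u * v)) := by
    ext w
    rw [christoffelLower_apply, fderiv_radialMetric h, fderiv_radialMetric h,
      fderiv_radialMetric h, radialMetric_apply]
    simp
    field_simp
    ring
  rw [christoffel_apply, this, sharp_radialMetric h0]
  simp

theorem trace_complex (T : ℂ →L[ℝ] ℂ) :
    LinearMap.trace ℝ ℂ T.toLinearMap = (T 1).re + (T Complex.I).im := by
  rw [LinearMap.trace_eq_matrix_trace ℝ Complex.basisOneI, Matrix.trace]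
  simp [LinearMap.toMatrix_apply, Fin.sum_univ_two]

/-- The Ricci tensor of a radial metric, in terms of `B(s) = s F'(s) / F(s) = s k(s)`. -/
theorem ricci_radialMetric {F F' : ℝ → ℝ} {k' : ℝ} {x : ℂ} (hx : x ≠ 0)
    (hF : ∀ s, 0 < s → HasDerivAt F (F' s) s) (h0 : ∀ s, 0 < s → F s ≠ 0)
    (hk : HasDerivAt (fun s => F' s / F s) k' (‖x‖ ^ 2)) (Y Z : ℂ) :
    ricci (radialMetric F) x Y Z =
      -2 * (F' (‖x‖ ^ 2) / F (‖x‖ ^ 2) + ‖x‖ ^ 2 * k') * (Y.re * Z.re + Y.im * Z.im) := by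
  -- The curvature differentiates the Christoffel symbols, so their formula is needed on a
  -- neighbourhood of x.
  have hev : christoffel (radialMetric F) =ᶠ[nhds x] fun y =>
      (((F' (‖y‖ ^ 2) / F (‖y‖ ^ 2) : ℝ) : ℂ) * conj y) • ContinuousLinearMap.mul ℝ ℂ := by
    filter_upwards [isOpen_ne.mem_nhds hx] with y hy
    exact christoffel_radialMetric (hF _ (normSq_pos hy)) (h0 _ (normSq_pos hy))
  have h1 := Complex.ofRealCLM.hasFDerivAt.comp x (hasFDerivAt_comp_normSq hk)
  have h2 := (h1.mul (Complex.conjCLE.hasFDerivAt (x := x))).smul_const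
    (ContinuousLinearMap.mul ℝ ℂ)
  have h3 := (h2.congr_of_eventuallyEq hev).fderiv
  have hch := hev.eq_of_nhds
  rw [ricci, trace_complex, curvature_apply, curvature_apply, h3, hch]
  simp [innerForm_apply]
  rw [norm_sq_eq]
  ring

theorem ricciForm_radialMetric {F F' : ℝ → ℝ} {k' : ℝ} {x : ℂ} (hx : x ≠ 0)
    (hF : ∀ s, 0 < s → HasDerivAt F (F' s) s) (h0 : ∀ s, 0 < s → F s ≠ 0)
    (hk : HasDerivAt (fun s => F' s / F s) k' (‖x‖ ^ 2)) (X Y : ℂ) :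
    ricciForm complexJ (radialMetric F) x X Y =
      -2 * (F' (‖x‖ ^ 2) / F (‖x‖ ^ 2) + ‖x‖ ^ 2 * k') * (X.re * Y.im - X.im * Y.re) := by
  rw [ricciForm, ricci_radialMetric hx hF h0 hk]
  simp only [complexJ, ContinuousLinearMap.mul_apply', Complex.mul_re, Complex.mul_im,
    Complex.I_re, Complex.I_im]
  ring

/-- The equation of Ricci magnetic geodesics in a radial metric. -/
theorem IsRMG.deriv_deriv {F F' k' : ℝ → ℝ} {lam : ℝ} {α : ℝ → ℂ}
    (hα : IsRMG complexJ (radialMetric F) lam α) (hne : ∀ t, α t ≠ 0)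
    (hF : ∀ s, 0 < s → HasDerivAt F (F' s) s) (h0 : ∀ s, 0 < s → F s ≠ 0)
    (hk : ∀ s, 0 < s → HasDerivAt (fun s => F' s / F s) (k' s) s) (t : ℝ) :
    F (‖α t‖ ^ 2) * deriv (deriv α) t + F' (‖α t‖ ^ 2) * conj (α t) * (deriv α t) ^ 2 =
      -2 * lam * (F' (‖α t‖ ^ 2) / F (‖α t‖ ^ 2) + ‖α t‖ ^ 2 * k' (‖α t‖ ^ 2) : ℝ) *
        (Complex.I * deriv α t) := by
  have hs := normSq_pos (hne t)
  have key : ∀ w, _ := hα.2 t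
  simp only [ricciForm_radialMetric (hne t) hF h0 (hk _ hs), covAccel,
    christoffel_radialMetric (hF _ hs) (h0 _ hs), radialMetric_apply] at key
  -- Testing against 1 and i recovers the real and imaginary parts.
  have h1 := key 1
  have h2 := key Complex.I
  have hne := h0 _ hs
  set f := F (‖α t‖ ^ 2)
  set f' := F' (‖α t‖ ^ 2)
  have e : f * (f' / f) = f' := by field_simp
  apply Complex.ext
  · simp [pow_two] at h1 ⊢
    linear_combination h1 - ((α t).re * ((deriv α t).re * (deriv α t).re - (deriv α t).im * (deriv α t).im) + (α t).im * ((deriv α t).re * (deriv α t).im + (deriv α t).im * (deriv α t).re)) * e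
  · simp [pow_two] at h2 ⊢
    linear_combination h2 - ((α t).re * ((deriv α t).re * (deriv α t).im + (deriv α t).im * (deriv α t).re) - (α t).im * ((deriv α t).re * (deriv α t).re - (deriv α t).im * (deriv α t).im)) * e

/-! ### Conserved quantities. -/

theorem hasDerivAt_normSq_comp {α : ℝ → ℂ} {v : ℂ} {t : ℝ} (h : HasDerivAt α v t) :
    HasDerivAt (fun t => ‖α t‖ ^ 2) (2 * ((α t).re * v.re + (α t).im * v.im)) t := by
  have h1 := ((hasStrictFDerivAt_norm_sq (α t)).hasFDerivAt).comp_hasDerivAt t h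
  refine h1.congr_deriv ?_
  have := innerForm_apply (α t) v
  change inner ℝ (α t) v = _ at this
  simp [this]
  ring

theorem hasDerivAt_re {α : ℝ → ℂ} {v : ℂ} {t : ℝ} (h : HasDerivAt α v t) :
    HasDerivAt (fun t => (α t).re) v.re t :=
  (Complex.reCLM.hasFDerivAt (x := α t)).comp_hasDerivAt t h

theorem hasDerivAt_im {α : ℝ → ℂ} {v : ℂ} {t : ℝ} (h : HasDerivAt α v t) :
    HasDerivAt (fun t => (α t).im) v.im t :=
  (Complex.imCLM.hasFDerivAt (x := α t)).comp_hasDerivAt t h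

theorem eq_of_hasDerivAt_zero {f : ℝ → ℝ} (h : ∀ t, HasDerivAt f 0 t) (s t : ℝ) : f s = f t :=
  is_const_of_deriv_eq_zero (fun t => (h t).differentiableAt) (fun t => (h t).deriv) s t

section Conservation

variable {F F' k' : ℝ → ℝ} {lam : ℝ} {α : ℝ → ℂ}

/-- Conservation of energy. -/
theorem IsRMG.energy (hα : IsRMG complexJ (radialMetric F) lam α) (hne : ∀ t, α t ≠ 0)
    (hF : ∀ s, 0 < s → HasDerivAt F (F' s) s) (h0 : ∀ s, 0 < s → F s ≠ 0)
    (hk : ∀ s, 0 < s → HasDerivAt (fun s => F' s / F s) (k' s) s) (s t : ℝ) :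
    F (‖α s‖ ^ 2) * ‖deriv α s‖ ^ 2 = F (‖α t‖ ^ 2) * ‖deriv α t‖ ^ 2 := by
  refine eq_of_hasDerivAt_zero (f := fun t => F (‖α t‖ ^ 2) * ‖deriv α t‖ ^ 2) (fun t => ?_) s t
  have d1 : HasDerivAt α (deriv α t) t :=
    (hα.1.differentiable (by simp)).differentiableAt.hasDerivAt
  have d2 : HasDerivAt (deriv α) (deriv (deriv α) t) t :=
    (((contDiff_infty_iff_deriv.1 hα.1).2).differentiable (by simp)).differentiableAt.hasDerivAt
  have hs := normSq_pos (hne t)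
  have key := hα.deriv_deriv hne hF h0 hk t
  have d3 := (hF _ hs).comp t (hasDerivAt_normSq_comp d1)
  refine (d3.mul (hasDerivAt_normSq_comp d2)).congr_deriv ?_
  have k1 := congrArg Complex.re key
  have k2 := congrArg Complex.im key
  simp [pow_two] at k1 k2
  rw [norm_sq_eq (deriv α t)]
  simp only [Function.comp_apply, pow_two] at *
  -- The equation is paired with α', to which the magnetic force, a real multiple of iα', is
  -- orthogonal.
  linear_combination 2 * (deriv α t).re * k1 + 2 * (deriv α t).im * k2

/-- Conservation of the angular momentum. -/
theorem IsRMG.angularMomentum (hα : IsRMG complexJ (radialMetric F) lam α) (hne : ∀ t, α t ≠ 0)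
    (hF : ∀ s, 0 < s → HasDerivAt F (F' s) s) (h0 : ∀ s, 0 < s → F s ≠ 0)
    (hk : ∀ s, 0 < s → HasDerivAt (fun s => F' s / F s) (k' s) s) (s t : ℝ) :
    F (‖α s‖ ^ 2) * ((α s).re * (deriv α s).im - (α s).im * (deriv α s).re) +
        lam * (‖α s‖ ^ 2 * (F' (‖α s‖ ^ 2) / F (‖α s‖ ^ 2))) =
      F (‖α t‖ ^ 2) * ((α t).re * (deriv α t).im - (α t).im * (deriv α t).re) +
        lam * (‖α t‖ ^ 2 * (F' (‖α t‖ ^ 2) / F (‖α t‖ ^ 2))) := by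
  refine eq_of_hasDerivAt_zero (f := fun t =>
    F (‖α t‖ ^ 2) * ((α t).re * (deriv α t).im - (α t).im * (deriv α t).re) +
        lam * (‖α t‖ ^ 2 * (F' (‖α t‖ ^ 2) / F (‖α t‖ ^ 2)))) (fun t => ?_) s t
  have d1 : HasDerivAt α (deriv α t) t :=
    (hα.1.differentiable (by simp)).differentiableAt.hasDerivAt
  have d2 : HasDerivAt (deriv α) (deriv (deriv α) t) t :=
    (((contDiff_infty_iff_deriv.1 hα.1).2).differentiable (by simp)).differentiableAt.hasDerivAt
  have hs := normSq_pos (hne t)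
  have key := hα.deriv_deriv hne hF h0 hk t
  have ds := hasDerivAt_normSq_comp d1
  have d3 := (hF _ hs).comp t ds
  have d4 := (hk _ hs).comp t ds
  refine ((d3.mul (((hasDerivAt_re d1).mul (hasDerivAt_im d2)).sub
    ((hasDerivAt_im d1).mul (hasDerivAt_re d2)))).add ((ds.mul d4).const_mul lam)).congr_deriv ?_
  have k1 := congrArg Complex.re key
  have k2 := congrArg Complex.im key
  simp [pow_two] at k1 k2
  simp only [Function.comp_apply, pow_two, Pi.mul_apply, Pi.sub_apply] at *
  -- The imaginary part of ᾱ times the equation: the magnetic term becomes -lam (sF'/F)' (|α|²)', a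
  -- total derivative.
  linear_combination (α t).re * k2 - (α t).im * k1

end Conservation

/-! ### The integrals over the sphere and their derivatives. -/

open MeasureTheory

/-- Multiples of this density dominate all the integrands below. -/
theorem integrable_sphere_density : Integrable (fun z : ℂ => 1 / (1 + ‖z‖ ^ 2) ^ 2) := by
  have h := integrable_rpow_neg_one_add_norm_sq (E := ℂ) (μ := volume) (r := 4)
    (by rw [Complex.finrank_real_complex]; norm_num)
  refine h.congr (Filter.Eventually.of_forall fun z => ?_)
  have : (0 : ℝ) ≤ 1 + ‖z‖ ^ 2 := by positivity
  simp only [one_div]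
  rw [show (-4 / 2 : ℝ) = -((2 : ℕ) : ℝ) by norm_num, Real.rpow_neg this, Real.rpow_natCast]

/-- Differentiation of `t ↦ ∫ m / (a + t b) ^ k` under the integral sign. -/
theorem hasDerivAt_integral_div_pow {m a b : ℂ → ℝ} (k : ℕ)
    (hm0 : ∀ z, 0 ≤ m z) (hb0 : ∀ z, 0 ≤ b z) (hpos : ∀ t, 0 < t → ∀ z, 0 < a z + t * b z)
    (hi : ∀ t, 0 < t → Integrable (fun z => m z / (a z + t * b z) ^ k))
    (hi' : ∀ t, 0 < t → Integrable (fun z => m z * b z / (a z + t * b z) ^ (k + 1)))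
    {t : ℝ} (ht : 0 < t) :
    HasDerivAt (fun t => ∫ z, m z / (a z + t * b z) ^ k)
      (-k * ∫ z, m z * b z / (a z + t * b z) ^ (k + 1)) t := by
  -- Since b ≥ 0, the size of the derivative decreases in the parameter; on (t/2, ∞) its value at
  -- t/2 dominates.
  have h := hasDerivAt_integral_of_dominated_loc_of_deriv_le (μ := volume) (x₀ := t)
    (s := Set.Ioi (t / 2)) (F := fun t z => m z / (a z + t * b z) ^ k)
    (F' := fun t z => -k * (m z * b z / (a z + t * b z) ^ (k + 1)))
    (bound := fun z => k * (m z * b z / (a z + t / 2 * b z) ^ (k + 1)))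
    (Ioi_mem_nhds (by linarith))
    (by
      filter_upwards [Ioi_mem_nhds ht] with s hs
      exact (hi s hs).aestronglyMeasurable)
    (hi t ht) ((hi' t ht).const_mul _).aestronglyMeasurable
    (Filter.Eventually.of_forall fun z s hs => by
      have h1 := hpos (t / 2) (by linarith) z
      have h2 : a z + t / 2 * b z ≤ a z + s * b z := by
        have := mul_le_mul_of_nonneg_right (le_of_lt hs) (hb0 z)
        linarith
      have h3 : 0 ≤ m z * b z := mul_nonneg (hm0 z) (hb0 z)
      have h4 := h1.trans_le h2
      rw [norm_mul, norm_neg, Real.norm_natCast,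
        Real.norm_of_nonneg (div_nonneg h3 (pow_nonneg h4.le _))]
      gcongr)
    ((hi' (t / 2) (by linarith)).const_mul _)
    (Filter.Eventually.of_forall fun z s hs => by
      have h1 := hpos s ((half_pos ht).trans hs) z
      have h2 : HasDerivAt (fun s => a z + s * b z) (b z) s := by
        simpa using ((hasDerivAt_id s).mul_const (b z)).const_add (a z)
      have h3 := ((h2.pow k).inv (pow_pos h1 k).ne').const_mul (m z)
      simp only [div_eq_mul_inv]
      refine h3.congr_deriv ?_
      rcases k with _ | k
      · simp
      · simp only [Pi.pow_apply, Nat.add_sub_cancel]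
        field_simp
        ring)
  rw [← integral_const_mul]
  exact h.2

/-- The integral of `x ^ j / (1 + s x) ^ (j + 1)`, with `x = |z| ^ (2 n)`, over the sphere (up to a
constant factor).  For `j = 1` it is the conformal factor of the metric of `RatEq n`, and the higher
`j` arise from it by differentiation in `s`. -/
def lumpMoment (n j : ℕ) (s : ℝ) : ℝ :=
  ∫ z : ℂ, (‖z‖ ^ (2 * n)) ^ j * (1 / (1 + ‖z‖ ^ 2) ^ 2) / (1 + s * ‖z‖ ^ (2 * n)) ^ (j + 1)

theorem continuous_sphere_density : Continuous (fun z : ℂ => 1 / (1 + ‖z‖ ^ 2) ^ 2) :=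
  continuous_const.div (by fun_prop) (fun z => by positivity)

theorem continuous_lumpMoment_integrand (n j : ℕ) {s : ℝ} (hs : 0 < s) : Continuous (fun z : ℂ =>
    (‖z‖ ^ (2 * n)) ^ j * (1 / (1 + ‖z‖ ^ 2) ^ 2) / (1 + s * ‖z‖ ^ (2 * n)) ^ (j + 1)) :=
  ((by fun_prop : Continuous fun z : ℂ => (‖z‖ ^ (2 * n)) ^ j).mul
    continuous_sphere_density).div (by fun_prop) (fun z => by positivity)

/-- With x = |z|^(2n), the factor x^j / (1 + s x)^(j+1) is at most s^(-j). -/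
theorem integrable_lumpMoment (n j : ℕ) {s : ℝ} (hs : 0 < s) : Integrable (fun z : ℂ =>
    (‖z‖ ^ (2 * n)) ^ j * (1 / (1 + ‖z‖ ^ 2) ^ 2) / (1 + s * ‖z‖ ^ (2 * n)) ^ (j + 1)) := by
  refine (integrable_sphere_density.const_mul ((s ^ j)⁻¹)).mono'
    (continuous_lumpMoment_integrand n j hs).aestronglyMeasurable
    (Filter.Eventually.of_forall fun z => ?_)
  rw [Real.norm_of_nonneg (by positivity)]
  set x := ‖z‖ ^ (2 * n)
  have hx : 0 ≤ x := by positivity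
  have h : x ^ j / (1 + s * x) ^ (j + 1) ≤ (s ^ j)⁻¹ := by
    rw [div_le_iff₀ (by positivity), inv_mul_eq_div, le_div_iff₀ (by positivity), ← mul_pow]
    calc (x * s) ^ j ≤ (1 + s * x) ^ j := by gcongr; linarith
      _ ≤ (1 + s * x) ^ (j + 1) := pow_le_pow_right₀ (by nlinarith [mul_nonneg hs.le hx]) (by simp)
  calc _ = x ^ j / (1 + s * x) ^ (j + 1) * (1 / (1 + ‖z‖ ^ 2) ^ 2) := by ring
    _ ≤ _ := by gcongr

theorem hasDerivAt_lumpMoment (n j : ℕ) {s : ℝ} (hs : 0 < s) :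
    HasDerivAt (lumpMoment n j) (-(j + 1) * lumpMoment n (j + 1) s) s := by
  have e : ∀ (s : ℝ) (z : ℂ), (‖z‖ ^ (2 * n)) ^ j * (1 / (1 + ‖z‖ ^ 2) ^ 2) * ‖z‖ ^ (2 * n) /
      (1 + s * ‖z‖ ^ (2 * n)) ^ (j + 1 + 1) = (‖z‖ ^ (2 * n)) ^ (j + 1) *
      (1 / (1 + ‖z‖ ^ 2) ^ 2) / (1 + s * ‖z‖ ^ (2 * n)) ^ (j + 1 + 1) := fun s z => by ring
  have h := hasDerivAt_integral_div_pow (j + 1)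
    (m := fun z => (‖z‖ ^ (2 * n)) ^ j * (1 / (1 + ‖z‖ ^ 2) ^ 2)) (a := fun _ => 1)
    (b := fun z => ‖z‖ ^ (2 * n)) (fun z => by positivity)
    (fun z => by positivity) (fun t ht z => by positivity)
    (fun t ht => integrable_lumpMoment n j ht)
    (fun t ht => by simpa only [e] using integrable_lumpMoment n (j + 1) ht) hs
  simp only [e] at h
  push_cast at h
  exact h

theorem lumpMoment_pos (n j : ℕ) {s : ℝ} (hs : 0 < s) : 0 < lumpMoment n j s :=
  integral_pos_of_integrable_nonneg_nonzero (x := 1) (continuous_lumpMoment_integrand n j hs)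
    (integrable_lumpMoment n j hs) (fun z => by positivity)
    (by
      rw [norm_one]
      positivity)

/-! ### Rescaled integrals, which stay bounded as c → 0. -/

/-- The integrals obtained from `lumpMoment` by scaling. -/
def scaledMoment (n k : ℕ) (t : ℝ) : ℝ :=
  ∫ y : ℂ, ‖y‖ ^ (2 * n) / (1 + ‖y‖ ^ (2 * n)) ^ 2 / (‖y‖ ^ 2 + t * 1) ^ k

/-- The bound is uniform in t: since k < n, the zero of the numerator at y = 0 absorbs the pole
|y|^(-2k) that appears as t → 0. -/
theorem scaledMoment_integrand_le {n k : ℕ} (hn : 5 ≤ n) (hk : k ≤ 4) {t : ℝ} (ht : 0 < t)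
    (y : ℂ) : ‖y‖ ^ (2 * n) / (1 + ‖y‖ ^ (2 * n)) ^ 2 / (‖y‖ ^ 2 + t * 1) ^ k ≤
      4 * (1 / (1 + ‖y‖ ^ 2) ^ 2) := by
  rw [pow_mul]
  obtain ⟨r, hr⟩ : ∃ r, r = ‖y‖ ^ 2 := ⟨_, rfl⟩
  have hr0 : 0 ≤ r := by rw [hr]; positivity
  rw [← hr]
  rw [div_div, mul_one_div, div_le_div_iff₀ (by positivity) (by positivity)]
  have h1 : r ^ k ≤ (r + t * 1) ^ k := by 
    gcongr
    linarith
  suffices h : r ^ n * (1 + r) ^ 2 ≤ 4 * ((1 + r ^ n) ^ 2 * r ^ k) by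
    refine h.trans ?_
    gcongr
  obtain ⟨m, rfl⟩ : ∃ m, n = m + k := ⟨n - k, by omega⟩
  have h2 : r ^ m * (1 + r) ^ 2 ≤ 4 * (1 + r ^ (m + k)) ^ 2 := by
    rcases le_total r 1 with h | h
    · have h3 : r ^ m ≤ 1 := pow_le_one₀ hr0 h
      have h4 : (0 : ℝ) ≤ r ^ (m + k) := by positivity
      calc r ^ m * (1 + r) ^ 2 ≤ 1 * (1 + 1) ^ 2 := by gcongr
        _ ≤ _ := by nlinarith
    · have h3 : r ^ m ≤ r ^ (m + k) := pow_le_pow_right₀ h (by omega)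
      have h4 : r ^ 2 ≤ (r ^ (m + k)) := pow_le_pow_right₀ h (by omega)
      have h5 : (0 : ℝ) ≤ r ^ (m + k) := by positivity
      calc r ^ m * (1 + r) ^ 2 ≤ r ^ (m + k) * (r + r) ^ 2 := by gcongr
        _ = 4 * (r ^ (m + k) * r ^ 2) := by ring
        _ ≤ 4 * (r ^ (m + k) * r ^ (m + k)) := by gcongr
        _ ≤ _ := by nlinarith
  calc r ^ (m + k) * (1 + r) ^ 2 = r ^ m * (1 + r) ^ 2 * r ^ k := by ring
    _ ≤ 4 * (1 + r ^ (m + k)) ^ 2 * r ^ k := by gcongr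
    _ = _ := by ring

theorem continuous_scaledMoment_numerator (n : ℕ) :
    Continuous fun y : ℂ => ‖y‖ ^ (2 * n) / (1 + ‖y‖ ^ (2 * n)) ^ 2 :=
  (by fun_prop : Continuous fun y : ℂ => ‖y‖ ^ (2 * n)).div (by fun_prop)
    (fun z => by positivity)

theorem continuous_scaledMoment_integrand (n k : ℕ) {t : ℝ} (ht : 0 < t) :
    Continuous fun y : ℂ => ‖y‖ ^ (2 * n) / (1 + ‖y‖ ^ (2 * n)) ^ 2 / (‖y‖ ^ 2 + t * 1) ^ k :=
  (continuous_scaledMoment_numerator n).div (by fun_prop) (fun z => by positivity)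

theorem integrable_scaledMoment {n k : ℕ} (hn : 5 ≤ n) (hk : k ≤ 4) {t : ℝ} (ht : 0 < t) :
    Integrable fun y : ℂ =>
      ‖y‖ ^ (2 * n) / (1 + ‖y‖ ^ (2 * n)) ^ 2 / (‖y‖ ^ 2 + t * 1) ^ k := by
  refine (integrable_sphere_density.const_mul 4).mono'
    (continuous_scaledMoment_integrand n k ht).aestronglyMeasurable
    (Filter.Eventually.of_forall fun z => ?_)
  rw [Real.norm_of_nonneg (by positivity)]
  exact scaledMoment_integrand_le hn hk ht z

/-- The factor `t * 1` in `scaledMoment` fits the shape `a z + t * b z` with b = 1. -/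
theorem hasDerivAt_scaledMoment {n k : ℕ} (hn : 5 ≤ n) (hk : k ≤ 3) {t : ℝ} (ht : 0 < t) :
    HasDerivAt (scaledMoment n k) (-k * scaledMoment n (k + 1) t) t := by
  have h := hasDerivAt_integral_div_pow k
    (m := fun y => ‖y‖ ^ (2 * n) / (1 + ‖y‖ ^ (2 * n)) ^ 2) (a := fun y => ‖y‖ ^ 2)
    (b := fun _ => 1)
    (fun z => by positivity) (fun z => zero_le_one) (fun t ht z => by positivity)
    (fun t ht => integrable_scaledMoment hn (by omega) ht)
    (fun t ht => by simpa only [mul_one] using integrable_scaledMoment (k := k + 1) hn (by omega) ht) ht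
  simp only [mul_one] at h
  unfold scaledMoment
  simpa only [mul_one] using h

theorem scaledMoment_nonneg (n k : ℕ) {t : ℝ} (ht : 0 < t) : 0 ≤ scaledMoment n k t :=
  integral_nonneg fun y => by positivity

theorem scaledMoment_pos {n k : ℕ} (hn : 5 ≤ n) (hk : k ≤ 4) {t : ℝ} (ht : 0 < t) :
    0 < scaledMoment n k t :=
  integral_pos_of_integrable_nonneg_nonzero (x := 1) (continuous_scaledMoment_integrand n k ht)
    (integrable_scaledMoment hn hk ht) (fun z => by positivity)
    (by
      rw [norm_one]
      positivity)

theorem scaledMoment_le {n k : ℕ} (hn : 5 ≤ n) (hk : k ≤ 4) {t : ℝ} (ht : 0 < t) :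
    scaledMoment n k t ≤ ∫ y : ℂ, 4 * (1 / (1 + ‖y‖ ^ 2) ^ 2) :=
  integral_mono (integrable_scaledMoment hn hk ht) (integrable_sphere_density.const_mul 4)
    (scaledMoment_integrand_le hn hk ht)

/-- For k = 2 this is the positive lower bound on the conformal factor near c = 0. -/
theorem scaledMoment_antitone {n k : ℕ} (hn : 5 ≤ n) (hk : k ≤ 4) {t : ℝ} (ht : 0 < t)
    (ht1 : t ≤ 1) : scaledMoment n k 1 ≤ scaledMoment n k t :=
  integral_mono (integrable_scaledMoment hn hk one_pos) (integrable_scaledMoment hn hk ht)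
    fun y => by
      dsimp only
      gcongr

/-- Substitute z = y/ρ. The Jacobian gives ρ^(-2), the numerator ρ^(-2n) and the sphere density ρ^4.
-/
theorem lumpMoment_scaling (n : ℕ) (hn : n ≠ 0) {ρ : ℝ} (hρ : 0 < ρ) :
    ρ ^ (2 * n - 2) * lumpMoment n 1 (ρ ^ (2 * n)) = scaledMoment n 2 (ρ ^ 2) := by
  obtain ⟨m, rfl⟩ : ∃ m, n = m + 1 := ⟨n - 1, by omega⟩
  have h := Measure.integral_comp_smul (volume : Measure ℂ) (fun z : ℂ =>
    (‖z‖ ^ (2 * (m + 1))) ^ 1 * (1 / (1 + ‖z‖ ^ 2) ^ 2) /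
      (1 + ρ ^ (2 * (m + 1)) * ‖z‖ ^ (2 * (m + 1))) ^ (1 + 1)) ρ⁻¹
  rw [Complex.finrank_real_complex, abs_of_pos (by positivity)] at h
  change _ = ((ρ⁻¹ ^ 2)⁻¹) • lumpMoment (m + 1) 1 (ρ ^ (2 * (m + 1))) at h
  have h2 : lumpMoment (m + 1) 1 (ρ ^ (2 * (m + 1))) = (ρ ^ 2)⁻¹ * ∫ y : ℂ,
      (fun z : ℂ => (‖z‖ ^ (2 * (m + 1))) ^ 1 * (1 / (1 + ‖z‖ ^ 2) ^ 2) /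
      (1 + ρ ^ (2 * (m + 1)) * ‖z‖ ^ (2 * (m + 1))) ^ (1 + 1)) (ρ⁻¹ • y) := by
    rw [h, smul_eq_mul]
    field_simp
  rw [h2, scaledMoment, ← integral_const_mul, ← integral_const_mul]
  congr 1
  ext y
  beta_reduce
  rw [norm_smul, norm_inv, Real.norm_of_nonneg hρ.le, show 2 * (m + 1) - 2 = 2 * m by omega]
  simp only [mul_pow, inv_pow, mul_one]
  have e1 : ρ ^ (2 * (m + 1)) * ((ρ ^ (2 * (m + 1)))⁻¹ * ‖y‖ ^ (2 * (m + 1))) =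
      ‖y‖ ^ (2 * (m + 1)) := by field_simp
  have e2 : 1 + (ρ ^ 2)⁻¹ * ‖y‖ ^ 2 = (‖y‖ ^ 2 + ρ ^ 2) / ρ ^ 2 := by field_simp; ring
  rw [e1, e2]
  field_simp
  ring

/-! ### The metric of `RatEq n` as a radial metric. -/

/-- The conformal factor of the metric of `RatEq n` as a function of `|c|²`. -/
def lumpFactor (n : ℕ) (s : ℝ) : ℝ := 16 * lumpMoment n 1 s

theorem eqMetric_eq (n : ℕ) : eqMetric n = radialMetric (lumpFactor n) := by
  funext c
  have hf : ∀ z : ℂ, fderiv ℝ (fun y => (lump n y).eval (RingHom.id ℂ) z) c =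
      (ContinuousLinearMap.mul ℝ ℂ).flip (z ^ n) := fun z => by
    simp only [eval_lump]
    exact ((ContinuousLinearMap.mul ℝ ℂ).flip (z ^ n)).fderiv
  rw [eqMetric, l2Metric, radialMetric, lumpFactor, lumpMoment, ← integral_const_mul,
    ← integral_smul_const]
  congr 1
  ext1 z
  rw [hf, eval_lump]
  ext1 u
  ext1 v
  change _ * innerForm (u * z ^ n) (v * z ^ n) = _ * innerForm u v
  have e : innerForm (u * z ^ n) (v * z ^ n) = ‖z‖ ^ (2 * n) * innerForm u v := by
    rw [mul_comm 2 n, pow_mul, ← norm_pow, norm_sq_eq, innerForm_apply, innerForm_apply]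
    simp only [Complex.mul_re, Complex.mul_im]
    ring
  rw [e, norm_mul, norm_pow, mul_pow, ← pow_mul, mul_comm n 2]
  ring

theorem hasDerivAt_lumpFactor (n : ℕ) {s : ℝ} (hs : 0 < s) :
    HasDerivAt (lumpFactor n) (-32 * lumpMoment n 2 s) s := by
  refine ((hasDerivAt_lumpMoment n 1 hs).const_mul 16).congr_deriv ?_
  push_cast
  ring

theorem lumpFactor_pos (n : ℕ) {s : ℝ} (hs : 0 < s) : 0 < lumpFactor n s :=
  mul_pos (by norm_num) (lumpMoment_pos n 1 hs)

/-- Existence suffices, because the conserved quantities do not involve k'. -/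
theorem exists_hasDerivAt_logDeriv_lumpFactor (n : ℕ) : ∃ k' : ℝ → ℝ, ∀ s, 0 < s →
    HasDerivAt (fun s => -32 * lumpMoment n 2 s / lumpFactor n s) (k' s) s :=
  ⟨_, fun _ hs => ((hasDerivAt_lumpMoment n 2 hs).const_mul (-32)).div
    (hasDerivAt_lumpFactor n hs) (lumpFactor_pos n hs).ne'⟩

/-- The logarithmic derivative `s F'(s) / F(s)` at `s = ρ ^ (2 n)`. -/
theorem logDeriv_lumpFactor {n : ℕ} (hn : 5 ≤ n) {ρ : ℝ} (hρ : 0 < ρ) :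
    n * (ρ ^ (2 * n) * (-32 * lumpMoment n 2 (ρ ^ (2 * n)) / lumpFactor n (ρ ^ (2 * n)))) =
      1 - n - 2 * ρ ^ 2 * (scaledMoment n 3 (ρ ^ 2) / scaledMoment n 2 (ρ ^ 2)) := by
  have hs : 0 < ρ ^ (2 * n) := by positivity
  -- Both sides of `lumpMoment_scaling` are differentiated in ρ and the results compared.
  have d1 : HasDerivAt (fun ρ => ρ ^ (2 * n - 2) * lumpMoment n 1 (ρ ^ (2 * n))) _ ρ :=
    (hasDerivAt_pow (2 * n - 2) ρ).mul
      ((hasDerivAt_lumpMoment n 1 hs).comp ρ (hasDerivAt_pow (2 * n) ρ))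
  have d2 : HasDerivAt (fun ρ => scaledMoment n 2 (ρ ^ 2)) _ ρ :=
    HasDerivAt.comp (h := fun ρ : ℝ => ρ ^ 2) ρ
      (hasDerivAt_scaledMoment hn (by norm_num) (by positivity)) (hasDerivAt_pow 2 ρ)
  have d3 := d2.congr_of_eventuallyEq (f₁ := fun ρ => ρ ^ (2 * n - 2) * lumpMoment n 1 (ρ ^ (2 * n)))
    (by
      filter_upwards [Ioi_mem_nhds hρ] with r hr
      exact lumpMoment_scaling n (by omega) hr)
  have e := d1.unique d3
  have e1 := lumpMoment_scaling n (by omega) hρ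
  have p1 := lumpMoment_pos n 1 hs
  have p2 := scaledMoment_pos hn (by norm_num : 2 ≤ 4) (by positivity : 0 < ρ ^ 2)
  rw [lumpFactor]
  rw [← e1] at p2 ⊢
  obtain ⟨m, rfl⟩ : ∃ m, n = m + 2 := ⟨n - 2, by omega⟩
  rw [show 2 * (m + 2) - 2 = 2 * m + 2 by omega] at *
  rw [show 2 * m + 2 - 1 = 2 * m + 1 by omega, show 2 * (m + 2) - 1 = 2 * m + 3 by omega] at e
  generalize lumpMoment (m + 2) 2 (ρ ^ (2 * (m + 2))) = A at *
  generalize lumpMoment (m + 2) 1 (ρ ^ (2 * (m + 2))) = B at *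
  norm_num at e
  field_simp
  push_cast
  linear_combination 8 * ρ * e

/-! ### Critical curves reach c = 0 in finite time. -/

/-- A positive function on the line cannot start at most at `1` with negative slope and have slope
of absolute value at least `1` as long as its values are at most `1`. -/
theorem false_of_steep {u : ℝ → ℝ} (hd : Differentiable ℝ u) (hc : Continuous (deriv u))
    (hpos : ∀ t, 0 < u t) (h0 : u 0 ≤ 1) (h0' : deriv u 0 < 0)
    (h : ∀ t, u t ≤ 1 → 1 ≤ deriv u t ^ 2) : False := by
  have anti : ∀ T, 0 ≤ T → (∀ t ∈ Set.Ioo 0 T, deriv u t < 0) → u T ≤ 1 := fun T hT hneg => by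
    refine le_trans ?_ h0
    have := antitoneOn_of_deriv_nonpos (convex_Icc 0 T) hd.continuous.continuousOn
      hd.differentiableOn (fun x hx => by
        rw [interior_Icc] at hx
        exact (hneg x hx).le)
    exact this (Set.left_mem_Icc.2 hT) (Set.right_mem_Icc.2 hT) hT
  have hneg : ∀ t, 0 ≤ t → deriv u t < 0 := by
    by_contra! hne
    -- At the first time T of nonnegative slope the slope is 0 by the intermediate value theorem,
    -- yet u T ≤ 1 requires it to be at least 1 in size.
    set S : Set ℝ := {t | 0 ≤ t ∧ 0 ≤ deriv u t}
    have hS : IsClosed S :=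
      (isClosed_le continuous_const continuous_id).inter (isClosed_le continuous_const hc)
    have hb : BddBelow S := ⟨0, fun t ht => ht.1⟩
    have hT : sInf S ∈ S := hS.csInf_mem hne hb
    set T := sInf S
    obtain ⟨c, hcT, hc0⟩ := intermediate_value_Icc hT.1 hc.continuousOn ⟨h0'.le, hT.2⟩
    have hcT' : c = T := le_antisymm hcT.2 (csInf_le hb ⟨hcT.1, hc0.ge⟩)
    have h1 := h T (anti T hT.1 fun t ht => by
      by_contra! h2
      exact absurd (csInf_le hb (show t ∈ S from ⟨ht.1.le, h2⟩)) (not_le.2 ht.2))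
    rw [← hcT', hc0] at h1
    norm_num at h1
  have hle : ∀ t, 0 ≤ t → deriv u t ≤ -1 := fun t ht => by
    have h1 := h t (anti t ht fun s hs => hneg s hs.1.le)
    have h2 := hneg t ht
    nlinarith
  have h2 := (convex_Icc (0 : ℝ) 2).image_sub_le_mul_sub_of_deriv_le hd.continuous.continuousOn
    hd.differentiableOn (C := -1) (fun x hx => by
      rw [interior_Icc] at hx
      exact hle x hx.1.le) 0 (by simp) 2 (by simp) (by norm_num)
  linarith [hpos 2]

/-- A bound from below, by the conserved energy, for the radial speed of a Ricci magnetic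
geodesic whose angular momentum has the critical value. -/
theorem one_le_sq_of_conserved {n : ℕ} (hn : 5 ≤ n) {ρ ρ' F G₂ G₃ M g E lam p q v : ℝ}
    (hρ : 0 < ρ) (hρ1 : ρ ≤ 1) (hg : 0 < g) (hgG : g ≤ G₂) (hGM : G₂ ≤ M) (hG0 : 0 ≤ G₃)
    (hG₃ : G₃ ≤ M) (hF : ρ ^ (2 * n - 2) * F = 16 * G₂)
    (hpq : p ^ 2 + q ^ 2 = ρ ^ (2 * n) * v) (hE : F * v = E)
    (hq : n * (F * q) = lam * (2 * ρ ^ 2 * (G₃ / G₂))) (hp : n * ρ ^ (2 * n - 1) * ρ' = p)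
    (hEb : 16 * n ^ 2 * M + lam ^ 2 * M ^ 2 / g ^ 3 ≤ E) : 1 ≤ ρ' ^ 2 := by
  have hG : 0 < G₂ := hg.trans_le hgG
  have hM : 0 < M := hG.trans_le hGM
  have hn1 : (1 : ℝ) ≤ n := by exact_mod_cast (by omega : 1 ≤ n)
  obtain ⟨m, rfl⟩ : ∃ m, n = m + 1 := ⟨n - 1, by omega⟩
  generalize ((m + 1 : ℕ) : ℝ) = N at *
  rw [show 2 * (m + 1) - 2 = 2 * m by omega] at hF
  rw [show 2 * (m + 1) - 1 = 2 * m + 1 by omega] at hp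
  have hρm : 0 < ρ ^ (2 * m) := by positivity
  -- the identity `n² ρ'² (16 G₂)² = 16 E G₂ - (2 lam ρ G₃ / (n G₂))²`
  have hq' : N * (16 * G₂ * q) = ρ ^ (2 * m) * (lam * (2 * ρ ^ 2 * (G₃ / G₂))) := by
    rw [← hq, ← hF]; ring
  set r := G₃ / G₂ with hr
  have key : N ^ 2 * ρ' ^ 2 * (16 * G₂) ^ 2 * N ^ 2 =
      16 * E * G₂ * N ^ 2 - (2 * lam * ρ * r) ^ 2 := by
    have h1 : (ρ ^ (2 * m + 1)) ^ 2 ≠ 0 := by positivity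
    apply mul_left_cancel₀ h1
    -- Here |α|²|α'|² is split into its radial and angular parts.
    have h2 : (N * ρ ^ (2 * m + 1) * ρ') ^ 2 = ρ ^ (2 * (m + 1)) * v - q ^ 2 := by
      rw [hp]; linarith
    have h3 : 16 * G₂ * v = ρ ^ (2 * m) * E := by rw [← hF, ← hE]; ring
    have h4 : (N * (16 * G₂ * q)) ^ 2 = (ρ ^ (2 * m) * (lam * (2 * ρ ^ 2 * r))) ^ 2 := by rw [hq']
    linear_combination (16 * G₂) ^ 2 * N ^ 2 * h2 - h4 + 16 * G₂ * N ^ 2 * ρ ^ (2 * (m + 1)) * h3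
  have hr0 : 0 ≤ r := by positivity
  have hrM : r ≤ M / g := by
    rw [hr]; gcongr
  have b1 : (2 * lam * ρ * r) ^ 2 ≤ 4 * lam ^ 2 * (M / g) ^ 2 := by
    calc (2 * lam * ρ * r) ^ 2 = 4 * lam ^ 2 * (ρ * r) ^ 2 := by ring
      _ ≤ 4 * lam ^ 2 * (1 * (M / g)) ^ 2 := by gcongr
      _ = _ := by ring
  -- In the energy threshold, 16 n² M pays for (16 G₂)² n² since G₂ ≤ M, and lam² M² / g³ pays for
  -- the angular term since G₃/G₂ ≤ M/g and g ≤ G₂.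
  have b2 : 16 * (16 * N ^ 2 * M + lam ^ 2 * M ^ 2 / g ^ 3) * G₂ ≤ 16 * E * G₂ := by gcongr
  have b3 : lam ^ 2 * (M / g) ^ 2 ≤ lam ^ 2 * M ^ 2 / g ^ 3 * G₂ := by
    calc lam ^ 2 * (M / g) ^ 2 = lam ^ 2 * M ^ 2 / g ^ 3 * g := by field_simp
      _ ≤ _ := by gcongr
  have b4 : (16 * G₂) ^ 2 * N ^ 2 ≤ 16 * E * G₂ - 16 * (lam ^ 2 * (M / g) ^ 2) := by
    have : N ^ 2 * (G₂ * G₂) ≤ N ^ 2 * (M * G₂) := by gcongr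
    nlinarith
  have hN2 : 1 ≤ N ^ 2 := by nlinarith
  have b5 : (16 * G₂) ^ 2 * N ^ 2 * N ^ 2 ≤ N ^ 2 * ρ' ^ 2 * (16 * G₂) ^ 2 * N ^ 2 := by
    rw [key]
    have h5 : 0 ≤ lam ^ 2 * (M / g) ^ 2 := by positivity
    have h6 := mul_le_mul_of_nonneg_right b4 (by positivity : 0 ≤ N ^ 2)
    have h7 := mul_le_mul_of_nonneg_left hN2 h5
    linarith
  have b6 : 0 < (16 * G₂) ^ 2 * N ^ 2 * N ^ 2 := by positivity
  refine le_of_mul_le_mul_right ?_ b6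
  linarith

/-- No Ricci magnetic geodesic of `RatEq n`, in the coordinate `c`, is defined on the whole line
and starts at `c = 1` inwards with the critical angular momentum and large energy. -/
theorem not_isRMG_of_critical {n : ℕ} (hn : 5 ≤ n) (lam : ℝ) {α : ℝ → ℂ}
    (hα : IsRMG complexJ (eqMetric n) lam α) (hne : ∀ t, α t ≠ 0) (h0 : α 0 = 1) {M : ℝ}
    (hM : ∀ k ≤ 4, ∀ t, 0 < t → scaledMoment n k t ≤ M) (hre : (deriv α 0).re < 0)
    (him : n * (lumpFactor n 1 * (deriv α 0).im) =
      lam * (2 * (scaledMoment n 3 1 / scaledMoment n 2 1)))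
    (hE : 16 * n ^ 2 * M + lam ^ 2 * M ^ 2 / scaledMoment n 2 1 ^ 3 ≤
      lumpFactor n 1 * ‖deriv α 0‖ ^ 2) : False := by
  rw [eqMetric_eq] at hα
  obtain ⟨k', hk⟩ := exists_hasDerivAt_logDeriv_lumpFactor n
  have hF : ∀ s, 0 < s → HasDerivAt (lumpFactor n) (-32 * lumpMoment n 2 s) s :=
    fun s hs => hasDerivAt_lumpFactor n hs
  have hF0 : ∀ s, 0 < s → lumpFactor n s ≠ 0 := fun s hs => (lumpFactor_pos n hs).ne'
  have energy := fun t => hα.energy hne hF hF0 hk t 0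
  have momentum := fun t => hα.angularMomentum hne hF hF0 hk t 0
  simp only [h0, norm_one, one_pow, Complex.one_re, Complex.one_im] at energy momentum
  have hn0 : 2 * n ≠ 0 := by omega
  -- This is ρ = |α|^(1/n), smooth because α never vanishes.
  set u : ℝ → ℝ := fun t => (‖α t‖ ^ 2) ^ (((2 * n : ℕ) : ℝ)⁻¹) with hu
  have hupos : ∀ t, 0 < u t := fun t => Real.rpow_pos_of_pos (normSq_pos (hne t)) _
  have hupow : ∀ t, u t ^ (2 * n) = ‖α t‖ ^ 2 := fun t =>
    Real.rpow_inv_natCast_pow (normSq_pos (hne t)).le hn0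
  have hu0 : u 0 = 1 := by simp [hu, h0]
  have husmooth : ContDiff ℝ ∞ u :=
    (hα.1.norm_sq ℝ).rpow_const_of_ne fun t => (normSq_pos (hne t)).ne'
  have hudiff : Differentiable ℝ u := husmooth.differentiable (by simp)
  have hp : ∀ t, n * u t ^ (2 * n - 1) * deriv u t =
      (α t).re * (deriv α t).re + (α t).im * (deriv α t).im := fun t => by
    have d1 : HasDerivAt α (deriv α t) t :=
      (hα.1.differentiable (by simp)).differentiableAt.hasDerivAt
    have d2 := (hudiff t).hasDerivAt.pow (2 * n)
    have e : u ^ (2 * n) = fun t => ‖α t‖ ^ 2 := funext hupow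
    rw [e] at d2
    have := d2.unique (hasDerivAt_normSq_comp d1)
    push_cast at this
    linarith
  have hlog := fun t => logDeriv_lumpFactor hn (hupos t)
  have hlog1 := hlog 0
  simp only [hu0, one_pow, mul_one, one_mul] at hlog1
  refine false_of_steep hudiff (husmooth.continuous_deriv (by simp)) hupos hu0.le ?_ fun t ht => ?_
  · have := hp 0
    rw [hu0, h0] at this
    simp at this
    have hn' : (0 : ℝ) < n := by exact_mod_cast (by omega : 0 < n)
    nlinarith
  · have hu2 : 0 < u t ^ 2 := by have := hupos t; positivity
    refine one_le_sq_of_conserved hn (M := M) (lam := lam) (hupos t) ht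
      (scaledMoment_pos hn (by norm_num : 2 ≤ 4) one_pos)
      (scaledMoment_antitone hn (by norm_num) hu2 (pow_le_one₀ (hupos t).le ht))
      (hM 2 (by norm_num) _ hu2) (scaledMoment_nonneg n 3 hu2) (hM 3 (by norm_num) _ hu2)
      (F := lumpFactor n (u t ^ (2 * n))) ?_
      (q := (α t).re * (deriv α t).im - (α t).im * (deriv α t).re) (v := ‖deriv α t‖ ^ 2) ?_ rfl
      ?_ (hp t) ?_
    · rw [lumpFactor, ← lumpMoment_scaling n (by omega) (hupos t)]
      ring
    · rw [hupow, norm_sq_eq, norm_sq_eq]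
      ring
    · have h1 := hlog t
      have h2 := momentum t
      rw [← hupow] at h2
      -- The constant 1 - n cancels between the times t and 0, and `him` removes what is left at
      -- time 0.
      linear_combination (n : ℝ) * h2 - lam * h1 + lam * hlog1 + him
    · rw [hupow, energy]
      exact hE

end RMG

end

theorem corollary4p5 (n : ℕ) (hn : 5 ≤ n) (lam : ℝ) : ¬ RMG.IntrinsicComplete n lam := by
  intro hcomplete
  have hn0 : n ≠ 0 := by omega
  obtain ⟨M, hM⟩ : ∃ M : ℝ, ∀ k ≤ 4, ∀ t, 0 < t → RMG.scaledMoment n k t ≤ M :=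
    ⟨_, fun k hk t ht => RMG.scaledMoment_le hn hk ht⟩
  have hF := RMG.lumpFactor_pos n one_pos
  set E : ℝ := 16 * n ^ 2 * M + lam ^ 2 * M ^ 2 / RMG.scaledMoment n 2 1 ^ 3 with hE
  -- The angular velocity y gives the critical momentum. The inward speed V ≥ 1 satisfies V² ≥ V, so
  -- the energy is at least F V = |E| + F with F = `lumpFactor n 1`.
  set y : ℝ := lam * (2 * (RMG.scaledMoment n 3 1 / RMG.scaledMoment n 2 1)) /
    (n * RMG.lumpFactor n 1) with hy
  set V : ℝ := |E| / RMG.lumpFactor n 1 + 1 with hV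
  have hV1 : 1 ≤ V := le_add_of_nonneg_left (by positivity)
  obtain ⟨α, hα, hα0, hαv⟩ := hcomplete
    ⟨RMG.lump n 1, (RMG.mem_ratEq_iff hn0 _).2 ⟨1, one_ne_zero, rfl⟩⟩ ⟨-V, y⟩
  refine RMG.not_isRMG_of_critical hn lam hα (fun t => ?_) ?_ hM ?_ ?_ ?_
  · obtain ⟨c, hc, h⟩ := (RMG.mem_ratEq_iff hn0 _).1 (α t).2
    rwa [h, RMG.coord_lump]
  · rw [hα0, RMG.coord_lump]
  · rw [hαv]
    simp only
    linarith
  · rw [hαv, hy]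
    have : (n : ℝ) ≠ 0 := by exact_mod_cast hn0
    field_simp
  · rw [hαv, RMG.norm_sq_eq, ← hE]
    have h1 : RMG.lumpFactor n 1 * V = |E| + RMG.lumpFactor n 1 := by
      rw [hV]; field_simp
    have h2 : V ≤ (-V) ^ 2 + y ^ 2 := by nlinarith [sq_nonneg y]
    have h3 := mul_le_mul_of_nonneg_left h2 hF.le
    linarith [le_abs_self E]
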